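/- Let $T$ be a totally transcendental first-order theory in a language $L$ with quantifier elimination and elimination of imaginaries. Let $\sigma$ be a new unary function symbol, $L_\sigma=L\cup\{\sigma\}$, and let $T_\sigma$ be the $L_\sigma$-theory $T\cup\{\forall x\,(\varphi(x)\leftrightarrow\varphi(\sigma(x))) : \varphi \text{ an } L\text{-formula}\}$. Assume that $T_\sigma$ has a model companion $T_A$, and let $E\models T_A$. Below, "definable" means $L$-definable with parameters in $E$; Morley rank $\operatorname{RM}$ and Morley degree are those of $L$-definable sets in the sense of $L$; a definable set is irreducible if its Morley degree is $1$. For a definable set $\mathcal A$, $\mathcal A^\sigma$ denotes the set defined by the same $L$-formula with $\sigma$ applied to the parameters. A subset $S$ of the set $\mathcal A(E)$ of $E$-points of an irreducible $\mathcal A$ is Zariski-dense in $\mathcal A$ over $E$ if it is contained in no definable $\mathcal C\subseteq\mathcal A$ with $\operatorname{RM}(\mathcal C)<\operatorname{RM}(\mathcal A)$. A rational function $f$ from $\mathcal B$ to $\mathcal A$ is a definable function with values in $\mathcal A$ whose domain is a Zariski-dense subset of $\mathcal B$; it is dominant if its image is Zariski-dense in $\mathcal A$, and finite if for some integer $k$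 the set of $b$ in its domain with $|f^{-1}(f(b))|=k$ has the same Morley rank as $\mathcal B$. Let $\mathcal A$ and $\mathcal B$ be irreducible definable sets, let $f$ be a finite dominant rational function from $\mathcal B$ to $\mathcal A$ and $g$ a finite dominant rational function from $\mathcal B$ to $\mathcal A^\sigma$, and put $$(\mathcal A,\mathcal B)^\sharp(E)=\{a\in\mathcal A(E) : (a,\sigma(a))=(f(b),g(b))\text{ for some } b\in\mathcal B(E) \text{ at which } f \text{ and } g \text{ are defined}\}.$$ Then $(\mathcal A,\mathcal B)^\sharp(E)$ is very dense in $(\mathcal A,\mathcal B)^\sharp$ over $E$, that is, it is Zariski-dense in $\mathcal A$ over $E$: it is not contained in any $L$-definable (with parameters in $E$) subset $\mathcal C\subseteq\mathcal A$ with $\operatorname{RM}(\mathcal C)<\operatorname{RM}(\mathcal A)$. -/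

import Mathlib

universe u v x y

open FirstOrder FirstOrder.Language

namespace DifferenceSets

/-! ### Model companions, quantifier elimination, elimination of imaginaries -/

section Theories

variable {L : FirstOrder.Language.{u, v}}

/-- A theory is model complete if every embedding between two of its models is elementary. -/
def IsModelComplete (T : L.Theory) : Prop :=
  ∀ (M N : Theory.ModelType.{u, v, x} T) (f : M ↪[L] N) (n : ℕ) (φ : L.Formula (Fin n))
    (a : Fin n → M), φ.Realize (f ∘ a) ↔ φ.Realize a

/-- `T'` is the model companion of `T`: every model of either theory embeds into a model of the
other one, and `T'` is model complete. -/
def IsModelCompanion (T T' : L.Theory) : Prop :=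
  (∀ M : Theory.ModelType.{u, v, x} T, ∃ N : Theory.ModelType.{u, v, x} T', Nonempty (M ↪[L] N)) ∧
  (∀ N : Theory.ModelType.{u, v, x} T', ∃ M : Theory.ModelType.{u, v, x} T, Nonempty (N ↪[L] M)) ∧
  IsModelComplete.{u, v, x} T'

/-- Quantifier elimination. Formulas are taken in a positive number of free variables, as usual,
so that languages without constant symbols are not excluded. -/
def HasQE (T : L.Theory) : Prop :=
  ∀ (n : ℕ) (φ : L.Formula (Fin (n + 1))), ∃ ψ : L.Formula (Fin (n + 1)),
    BoundedFormula.IsQF ψ ∧ T.Iff φ ψ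

/-- Elimination of imaginaries: in every model, every class of a `∅`-definable equivalence relation
on `n`-tuples has a (real) canonical parameter, that is, it is defined by some formula `ψ(x, b)` for
exactly one tuple `b`. -/
def HasEI (T : L.Theory) : Prop :=
  ∀ (M : Theory.ModelType.{u, v, x} T) (n : ℕ) (θ : L.Formula (Fin n ⊕ Fin n)),
    Equivalence (fun a c : Fin n → M => θ.Realize (Sum.elim a c)) →
    ∀ a : Fin n → M, ∃ (m : ℕ) (ψ : L.Formula (Fin n ⊕ Fin m)), ∃! b : Fin m → M,
      ∀ c : Fin n → M, θ.Realize (Sum.elim c a) ↔ ψ.Realize (Sum.elim c b)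

end Theories

/-! ### Formulas with parameters, Morley rank and Morley degree -/

section Morley

/-- `L`-formulas in the variables `ι` with parameters from `M`: the variables indexed by `M` stand
for the parameters. -/
abbrev ParamFormula (L : FirstOrder.Language.{u, v}) (M : Type x) (ι : Type) := L.Formula (M ⊕ ι)

variable {L : FirstOrder.Language.{u, v}} {M : Type x} {N : Type y} {ι : Type}

/-- The set of `M`-points of a formula over `M`. -/
def defSet [L.Structure M] (φ : ParamFormula L M ι) : Set (ι → M) :=
  {a | φ.Realize (Sum.elim id a)}

/-- Replace the parameters of a formula by their images under `j`. -/
def push (j : M → N) (φ : ParamFormula L M ι) : ParamFormula L N ι :=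
  φ.relabel (Sum.map j id)

/-- `MorleyRankGE α M φ` means `RM(φ) ≥ α`: the formula `φ` is consistent and, for every `β < α`,
there are infinitely many pairwise disjoint definable subsets of `φ` of Morley rank at least `β`.
As usual, the parameters defining the subsets may come from any elementary extension `N` of `M`
(equivalently, from a fixed monster model). Inconsistent formulas have rank `-∞`. -/
def MorleyRankGE (α : Ordinal.{x}) (M : Type x) [L.Structure M] (φ : ParamFormula L M ι) : Prop :=
  (defSet φ).Nonempty ∧ ∀ β : Ordinal.{x}, β < α →
    ∃ (N : Type x) (_ : L.Structure N) (j : M ↪ₑ[L] N) (ψ : ℕ → ParamFormula L N ι),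
      (∀ i, defSet (ψ i) ⊆ defSet (push j φ)) ∧
      (∀ i k, i ≠ k → Disjoint (defSet (ψ i)) (defSet (ψ k))) ∧
      ∀ i, MorleyRankGE β N (ψ i)
termination_by α

/-- `RM(φ) = α`. -/
def MorleyRankEq (α : Ordinal.{x}) (M : Type x) [L.Structure M] (φ : ParamFormula L M ι) : Prop :=
  MorleyRankGE α M φ ∧ ¬ MorleyRankGE (Order.succ α) M φ

/-- `RM(φ) < RM(ψ)`, where ranks lie in `{-∞} ∪ Ordinals ∪ {∞}`. -/
def MorleyRankLT [L.Structure M] {κ : Type} (φ : ParamFormula L M ι) (ψ : ParamFormula L M κ) :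
    Prop :=
  ∃ α : Ordinal.{x}, MorleyRankGE α M ψ ∧ ¬ MorleyRankGE α M φ

/-- `RM(φ) = RM(ψ)`. -/
def SameMorleyRank [L.Structure M] {κ : Type} (φ : ParamFormula L M ι) (ψ : ParamFormula L M κ) :
    Prop :=
  ∀ α : Ordinal.{x}, MorleyRankGE α M φ ↔ MorleyRankGE α M ψ

/-- Over some elementary extension there are `d` pairwise disjoint definable subsets of `φ` of Morley
rank at least `α`. When `RM(φ) = α`, this says that the Morley degree of `φ` is at least `d`. -/
def MorleyDegreeGE (α : Ordinal.{x}) (d : ℕ) (M : Type x) [L.Structure M]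
    (φ : ParamFormula L M ι) : Prop :=
  ∃ (N : Type x) (_ : L.Structure N) (j : M ↪ₑ[L] N) (ψ : Fin d → ParamFormula L N ι),
    (∀ i, defSet (ψ i) ⊆ defSet (push j φ)) ∧
    (∀ i k, i ≠ k → Disjoint (defSet (ψ i)) (defSet (ψ k))) ∧
    ∀ i, MorleyRankGE α N (ψ i)

/-- A definable set is irreducible if it has Morley degree `1`. -/
def IsIrreducible [L.Structure M] (φ : ParamFormula L M ι) : Prop :=
  ∃ α : Ordinal.{x}, MorleyRankEq α M φ ∧ MorleyDegreeGE α 1 M φ ∧ ¬ MorleyDegreeGE α 2 M φ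

/-- A theory is totally transcendental if every formula over every model has ordinal-valued (or
`-∞`) Morley rank. -/
def IsTotallyTranscendental (T : L.Theory) : Prop :=
  ∀ (M : Theory.ModelType.{u, v, x} T) (n : ℕ) (φ : ParamFormula L M (Fin n)),
    ∃ α : Ordinal.{x}, ¬ MorleyRankGE α M φ

end Morley

/-! ### Zariski density and rational functions -/

section Rational

variable {L : FirstOrder.Language.{u, v}} {E : Type x} [L.Structure E] {ι κ : Type}

/-- `S` is a subset of `A` which is Zariski-dense in `A` over (the whole model) `E`: it is not
contained in any `E`-definable subset of `A` of smaller Morley rank. -/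
def ZariskiDense (S : Set (ι → E)) (A : ParamFormula L E ι) : Prop :=
  S ⊆ defSet A ∧ ∀ C : ParamFormula L E ι,
    defSet C ⊆ defSet A → MorleyRankLT C A → ¬ S ⊆ defSet C

/-- A rational function from `B` to `A`, defined over `E`: an `L`-definable function
(given by its graph) with values in `A` whose domain is a Zariski-dense subset of `B`. -/
structure RationalFunction (B : ParamFormula L E ι) (A : ParamFormula L E κ) where
  /-- The formula defining the graph. -/
  graph : ParamFormula L E (ι ⊕ κ)
  functional : ∀ (b : ι → E) (a a' : κ → E), Sum.elim b a ∈ defSet graph →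
    Sum.elim b a' ∈ defSet graph → a = a'
  maps_to : ∀ (b : ι → E) (a : κ → E), Sum.elim b a ∈ defSet graph → a ∈ defSet A
  dense_domain : ZariskiDense {b : ι → E | ∃ a : κ → E, Sum.elim b a ∈ defSet graph} B

namespace RationalFunction

variable {B : ParamFormula L E ι} {A : ParamFormula L E κ}

/-- `f` is defined at `b` with value `a`. -/
def Maps (f : RationalFunction B A) (b : ι → E) (a : κ → E) : Prop :=
  Sum.elim b a ∈ defSet f.graph

/-- `f` is finite: for some integer `k`, the set of `b` whose fibre `f⁻¹(f(b))` has exactly `k`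
elements has the same Morley rank as `B`. -/
def IsFinite (f : RationalFunction B A) : Prop :=
  ∃ (k : ℕ) (φ : ParamFormula L E ι),
    defSet φ = {b | ∃ a, f.Maps b a ∧ {b' | f.Maps b' a}.encard = k} ∧ SameMorleyRank φ B

/-- `f` is dominant: its image is Zariski-dense in `A`. -/
def IsDominant (f : RationalFunction B A) : Prop :=
  ZariskiDense {a | ∃ b, f.Maps b a} A

end RationalFunction

end Rational

/-! ### The language with a new unary function symbol, and the theory of endomorphisms -/

section Sigma

/-- The only symbol is one unary function symbol. -/
inductive SigmaSymbol : ℕ → Type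
  | sigma : SigmaSymbol 1

/-- The language with one unary function symbol. -/
def sigmaLang : FirstOrder.Language.{0, 0} := ⟨SigmaSymbol, fun _ => Empty⟩

/-- The language `L ∪ {σ}`. -/
abbrev withSigma (L : FirstOrder.Language.{u, v}) : FirstOrder.Language.{u, v} := L.sum sigmaLang

/-- The new function symbol `σ`. -/
def sigmaSymb (L : FirstOrder.Language.{u, v}) : (withSigma L).Functions 1 := Sum.inr SigmaSymbol.sigma

/-- The interpretation of `σ`. -/
def sig (L : FirstOrder.Language.{u, v}) {E : Type x} [(withSigma L).Structure E] (e : E) : E :=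
  Structure.funMap (sigmaSymb L) ![e]

/-- The sentence `∀ x, φ(x) ↔ φ(σ(x))`. -/
noncomputable def invarianceSentence {L : FirstOrder.Language.{u, v}} {n : ℕ} (φ : L.Formula (Fin n)) :
    (withSigma L).Sentence :=
  let ψ : (withSigma L).Formula (Fin n) := (LHom.sumInl : L →ᴸ withSigma L).onFormula φ
  let ψσ : (withSigma L).Formula (Fin n) :=
    BoundedFormula.subst ψ fun i => (sigmaSymb L).apply₁ (Term.var i)
  Formula.iAlls (α := Empty) (Fin n) (Formula.relabel Sum.inr (ψ.iff ψσ))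

/-- The theory `T_σ`: `T` together with all sentences `∀ x, φ(x) ↔ φ(σ(x))`, `φ` an `L`-formula. -/
def sigmaTheory {L : FirstOrder.Language.{u, v}} (T : L.Theory) : (withSigma L).Theory :=
  (LHom.sumInl : L →ᴸ withSigma L).onTheory T ∪
    {s | ∃ (n : ℕ) (φ : L.Formula (Fin n)), s = invarianceSentence φ}

theorem realize_invarianceSentence {L : FirstOrder.Language.{u, v}} {E : Type x} [L.Structure E]
    [(withSigma L).Structure E] [(LHom.sumInl : L →ᴸ withSigma L).IsExpansionOn E]
    {n : ℕ} (φ : L.Formula (Fin n)) :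
    E ⊨ invarianceSentence φ ↔ ∀ a : Fin n → E, φ.Realize a ↔ φ.Realize (sig L ∘ a) := by
  unfold invarianceSentence Sentence.Realize
  rw [Formula.realize_iAlls]
  refine forall_congr' fun a => ?_
  rw [Formula.realize_relabel, Formula.realize_iff, LHom.realize_onFormula]
  refine iff_congr Iff.rfl ?_
  rw [Formula.Realize, BoundedFormula.realize_subst]
  rw [← Formula.Realize, LHom.realize_onFormula]
  refine iff_of_eq (congrArg _ (funext fun i => ?_))
  simp [sig]

end Sigma

/-! ### Sharps -/

section Sharp

variable {L : FirstOrder.Language.{u, v}} {E : Type x} [L.Structure E] [(withSigma L).Structure E]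

/-- `A^σ`: the set defined by the formula defining `A`, with `σ` applied to the parameters. -/
def twist {ι : Type} (A : ParamFormula L E ι) : ParamFormula L E ι := push (sig L) A

variable {ι κ : Type} {A : ParamFormula L E ι} {B : ParamFormula L E κ}

/-- The set `(A, B)^♯` of all `a` such that `(a, σ(a))` lies in the image `{(f(b), g(b)) | b}`. -/
def sharp (f : RationalFunction B A) (g : RationalFunction B (twist A)) : Set (ι → E) :=
  {a | ∃ b : κ → E, f.Maps b a ∧ g.Maps b (sig L ∘ a)}

/-- `S ⊆ (A, B)^♯` is very dense in `(A, B)^♯` over `E` if it is Zariski-dense in `A` over `E`. -/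
def IsVeryDense (S : Set (ι → E)) (f : RationalFunction B A) (g : RationalFunction B (twist A)) :
    Prop :=
  S ⊆ sharp f g ∧ ZariskiDense S A

end Sharp

end DifferenceSets

/-!
Let `σ` be the endomorphism of `E`, `B` irreducible of rank `β`, `A` irreducible of rank `α`, and
`C ⊆ A` of rank less than `α`; a point of `(A, B)^♯` outside `C` has to be found.

* A finite dominant rational function on `B` pulls definable sets of rank `< α` back to sets of rank
  `< β` (`RationalFunction.isSmall_preimage`). This rests on the fact that definable relations with
  fibres of bounded size do not lower Morley rank (`MorleyRankGE.of_fibres`). Hence if `b` is a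
  generic point of `B` over `E`, then `a = f(b)` and `a' = g(b)` lie in no set over `E` of rank
  `< α` (`exists_generic_point`).
* As `A` has degree `1`, this determines the types of `a` and `a'` over `E`: since Morley rank is
  invariant under elementary maps (`morleyRankGE_push_iff`), the map which extends `σ` by `a ↦ a'`
  is partial elementary. Amalgamation (`exists_amalgam`) and a union of an elementary chain
  (`exists_elementary_endomorphism`) extend it to an elementary self-map `τ` of an elementary
  extension of `E`, and `(P, τ)` is a model of `T_σ` (`exists_extension_generic_point`).
* Embed `(P, τ)` in a model `N` of `T_A`. By model completeness `N` is an elementary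
  `L_σ`-extension of `E`, and by quantifier elimination `P` is an elementary `L`-substructure of `N`
  (`exists_elementary_extension_of_endomorphism`). So `N` contains a point of `(A, B)^♯` outside
  `C`, and therefore so does `E`.

Generic points and amalgams are found in ultrapowers, by Łoś's theorem.
-/

namespace DifferenceSets

/-! ### Elementary amalgamation -/

section Amalgam

variable {L : FirstOrder.Language.{u, v}}

open Classical in
/-- A formula true of `N` can be realized in `M` by a map `N → M` with prescribed values `p i` at
`q i`, provided that `p` and `q` satisfy the same formulas: the finitely many free variables outside
the range of `q` are quantified existentially. -/
theorem exists_extension_realize {M N : Type*} [L.Structure M] [L.Structure N] [Nonempty M]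
    {I : Type*} {p : I → M} {q : I → N} (h : ∀ φ : L.Formula I, φ.Realize p ↔ φ.Realize q)
    (φ : L.Formula N) (hφ : φ.Realize id) :
    ∃ s : N → M, (∀ i, s (q i) = p i) ∧ φ.Realize s := by
  let c : φ.freeVarFinset → I ⊕ φ.freeVarFinset := fun n =>
    if hn : ∃ i, q i = n then Sum.inl hn.choose else Sum.inr n
  let ψ : L.Formula (I ⊕ φ.freeVarFinset) :=
    Formula.relabel c (BoundedFormula.restrictFreeVar φ id : L.Formula _)
  have hψ : (ψ.iExs φ.freeVarFinset).Realize q := by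
    rw [Formula.realize_iExs]
    refine ⟨fun n => n, ?_⟩
    rw [Formula.realize_relabel]
    refine (BoundedFormula.realize_restrictFreeVar (φ := φ) id (fun n => ?_)).2 hφ
    by_cases hn : ∃ i, q i = n
    · simpa [c, hn] using hn.choose_spec
    · simp [c, hn]
  obtain ⟨w, hw⟩ := Formula.realize_iExs.1 ((h _).2 hψ)
  rw [Formula.realize_relabel] at hw
  let s : N → M := fun n =>
    if hn : ∃ i, q i = n then p hn.choose
    else if hF : n ∈ φ.freeVarFinset then w ⟨n, hF⟩ else Classical.arbitrary M
  refine ⟨s, fun i => ?_, ?_⟩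
  · have hi : ∃ i', q i' = q i := ⟨i, rfl⟩
    have := (h ((Term.var hi.choose).equal (Term.var i))).2 (by
      simpa [Formula.realize_equal] using hi.choose_spec)
    simp only [s, dif_pos hi]
    simpa [Formula.realize_equal] using this
  · refine (BoundedFormula.realize_restrictFreeVar (φ := φ) s (fun n => ?_)).1 hw
    by_cases hn : ∃ i, q i = n
    · simp [c, s, hn]
    · simp [c, s, hn]

/-- Elementary amalgamation over a common family of elements. The amalgam is an ultrapower of `M`
indexed by the set-theoretic maps `N → M`. -/
theorem exists_amalgam {M N : Type x} [L.Structure M] [L.Structure N] [Nonempty M]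
    {I : Type*} {p : I → M} {q : I → N} (h : ∀ φ : L.Formula I, φ.Realize p ↔ φ.Realize q) :
    ∃ (P : Type x) (_ : L.Structure P) (j : M ↪ₑ[L] P) (k : N ↪ₑ[L] P),
      ∀ i, j (p i) = k (q i) := by
  let F : Filter (N → M) :=
    { sets := {S | ∃ φ : L.Formula N, φ.Realize id ∧
        ∀ s : N → M, (∀ i, s (q i) = p i) → φ.Realize s → s ∈ S}
      univ_sets := ⟨⊤, by simp, by simp⟩
      sets_of_superset := fun ⟨φ, h1, h2⟩ hST => ⟨φ, h1, fun s hs hφ => hST (h2 s hs hφ)⟩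
      inter_sets := fun ⟨φ, h1, h2⟩ ⟨φ', h1', h2'⟩ => ⟨φ ⊓ φ', by simp [h1, h1'],
        fun s hs hφ => ⟨h2 s hs (Formula.realize_inf.1 hφ).1,
          h2' s hs (Formula.realize_inf.1 hφ).2⟩⟩ }
  have hF : F.NeBot := by
    rw [← Filter.forall_mem_nonempty_iff_neBot]
    rintro S ⟨φ, h1, h2⟩
    obtain ⟨s, hs, hφ⟩ := exists_extension_realize h φ h1
    exact ⟨s, h2 s hs hφ⟩
  let U : Ultrafilter (N → M) := Ultrafilter.of F
  have hU : ∀ S ∈ F, S ∈ U := fun S hS => Ultrafilter.of_le F hS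
  let P := (U : Filter (N → M)).Product fun _ => M
  let j : M ↪ₑ[L] P :=
    { toFun := fun m => ((fun _ => m : (N → M) → M) : P)
      map_formula' := fun n φ a => by
        refine (Ultraproduct.realize_formula_cast (u := U) φ fun i _ => a i).trans ?_
        simp }
  let k : N ↪ₑ[L] P :=
    { toFun := fun b => ((fun s => s b : (N → M) → M) : P)
      map_formula' := fun n φ a => by
        refine (Ultraproduct.realize_formula_cast (u := U) φ fun i s => s (a i)).trans ?_
        have key : ∀ φ : L.Formula (Fin n), φ.Realize a →
            ∀ᶠ s : N → M in (U : Filter (N → M)), φ.Realize fun i => s (a i) := fun φ hφ =>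
          hU _ ⟨φ.relabel a, by simpa [Formula.realize_relabel] using hφ,
            fun s _ hs => Formula.realize_relabel.1 hs⟩
        refine ⟨fun hφ => by_contra fun hn => ?_, key φ⟩
        have := key φ.not (Formula.realize_not.2 hn)
        obtain ⟨s, hs, hs'⟩ := (hφ.and this).exists
        exact Formula.realize_not.1 hs' hs }
  refine ⟨P, inferInstance, j, k, fun i => Quotient.sound ?_⟩
  exact hU _ ⟨⊤, by simp, fun s hs _ => (hs i).symm⟩

/-- Two elementary extensions of `M` have a common elementary extension over `M`. -/
theorem exists_amalgam_over {M N N' : Type x} [L.Structure M] [L.Structure N] [L.Structure N']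
    [Nonempty N] (f : M ↪ₑ[L] N) (g : M ↪ₑ[L] N') :
    ∃ (P : Type x) (_ : L.Structure P) (j : N ↪ₑ[L] P) (k : N' ↪ₑ[L] P),
      ∀ m, j (f m) = k (g m) :=
  exists_amalgam (p := f) (q := g) fun φ =>
    (f.map_formula φ id).trans (g.map_formula φ id).symm

end Amalgam

/-! ### Elementary chains and extension of partial elementary maps -/

section Chain

variable {L : FirstOrder.Language.{u, v}}

theorem realize_natLERec {G : ℕ → Type x} [∀ i, L.Structure (G i)] (f : ∀ i, G i ↪ₑ[L] G (i + 1))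
    {i j : ℕ} (hij : i ≤ j) {α : Type*} {n : ℕ} (φ : L.BoundedFormula α n) (a : α → G i)
    (b : Fin n → G i) :
    φ.Realize (DirectedSystem.natLERec (fun i => (f i).toEmbedding) i j hij ∘ a)
      (DirectedSystem.natLERec (fun i => (f i).toEmbedding) i j hij ∘ b) ↔ φ.Realize a b := by
  induction j, hij using Nat.le_induction with
  | base =>
    have : (DirectedSystem.natLERec (fun i => (f i).toEmbedding) i i le_rfl : G i → G i) = id := by
      ext; simp [Nat.leRecOn_self]
    rw [this, Function.id_comp, Function.id_comp]
  | succ j hij ih =>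
    have : (DirectedSystem.natLERec (fun i => (f i).toEmbedding) i (j + 1) (hij.trans j.le_succ) :
        G i → G (j + 1)) =
        f j ∘ DirectedSystem.natLERec (fun i => (f i).toEmbedding) i j hij := by
      ext; simp [Nat.leRecOn_succ hij]
    rw [this, Function.comp_assoc, Function.comp_assoc, (f j).map_boundedFormula, ih]

/-- The elementary chain theorem for chains of order type `ω`. -/
theorem realize_directLimit_of {G : ℕ → Type x} [∀ i, L.Structure (G i)]
    (f : ∀ i, G i ↪ₑ[L] G (i + 1)) {α : Type*} {n : ℕ} (φ : L.BoundedFormula α n) (i : ℕ)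
    (a : α → G i) (b : Fin n → G i) :
    φ.Realize
      (DirectLimit.of L ℕ G (DirectedSystem.natLERec fun i => (f i).toEmbedding) i ∘ a)
      (DirectLimit.of L ℕ G (DirectedSystem.natLERec fun i => (f i).toEmbedding) i ∘ b) ↔
      φ.Realize a b := by
  induction φ generalizing i with
  | falsum => rfl
  | equal =>
    simp only [BoundedFormula.Realize, ← Sum.comp_elim, HomClass.realize_term,
      EmbeddingLike.apply_eq_iff_eq]
  | rel =>
    simp only [BoundedFormula.Realize, ← Sum.comp_elim, HomClass.realize_term]
    exact StrongHomClass.map_rel _ _ _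
  | imp φ ψ h1 h2 => exact imp_congr (h1 i a b) (h2 i a b)
  | all φ ih =>
    simp only [BoundedFormula.realize_all]
    refine ⟨fun h m => ?_, fun h z => ?_⟩
    · refine (ih i a _).1 ?_
      rw [Fin.comp_snoc]
      exact h _
    · obtain ⟨j, y, rfl⟩ := DirectLimit.exists_of z
      obtain ⟨k, hik, hjk⟩ := exists_ge_ge i j
      have ha : DirectLimit.of L ℕ G (DirectedSystem.natLERec fun i => (f i).toEmbedding) i ∘ a =
          DirectLimit.of L ℕ G (DirectedSystem.natLERec fun i => (f i).toEmbedding) k ∘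
            (DirectedSystem.natLERec (fun i => (f i).toEmbedding) i k hik ∘ a) :=
        funext fun _ => DirectLimit.of_f.symm
      have hb : DirectLimit.of L ℕ G (DirectedSystem.natLERec fun i => (f i).toEmbedding) i ∘ b =
          DirectLimit.of L ℕ G (DirectedSystem.natLERec fun i => (f i).toEmbedding) k ∘
            (DirectedSystem.natLERec (fun i => (f i).toEmbedding) i k hik ∘ b) :=
        funext fun _ => DirectLimit.of_f.symm
      rw [ha, hb, ← DirectLimit.of_f (hij := hjk), ← Fin.comp_snoc]
      refine (ih k _ _).2 ?_
      have := (realize_natLERec f hik φ.all a b).2 (BoundedFormula.realize_all.2 h)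
      exact BoundedFormula.realize_all.1 this _

/-- Two consecutive links of the chain used to extend a partial elementary map: elementary
extensions `inc` and elementary maps `mv` from `M` to `N`. -/
structure Link (L : FirstOrder.Language.{u, v}) where
  M : Type x
  N : Type x
  [strM : L.Structure M]
  [strN : L.Structure N]
  [nonempty : Nonempty N]
  inc : M ↪ₑ[L] N
  mv : M ↪ₑ[L] N

attribute [instance] Link.strM Link.strN Link.nonempty

theorem Link.exists_next (l : Link.{u, v, x} L) : ∃ (P : Type x) (_ : L.Structure P)
    (_ : Nonempty P) (j k : l.N ↪ₑ[L] P), ∀ m, j (l.mv m) = k (l.inc m) := by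
  obtain ⟨P, _, j, k, h⟩ := exists_amalgam_over l.mv l.inc
  exact ⟨P, _, l.nonempty.map j, j, k, h⟩

/-- The next link of the chain. -/
noncomputable def Link.next (l : Link.{u, v, x} L) : Link.{u, v, x} L :=
  let P := l.exists_next.choose
  letI : L.Structure P := l.exists_next.choose_spec.choose
  haveI : Nonempty P := l.exists_next.choose_spec.choose_spec.choose
  { M := l.N
    N := P
    inc := l.exists_next.choose_spec.choose_spec.choose_spec.choose
    mv := l.exists_next.choose_spec.choose_spec.choose_spec.choose_spec.choose }

theorem Link.next_inc_mv (l : Link.{u, v, x} L) (m : l.M) :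
    l.next.inc (l.mv m) = l.next.mv (l.inc m) :=
  l.exists_next.choose_spec.choose_spec.choose_spec.choose_spec.choose_spec m

/-- The chain obtained by iterating `Link.next`. -/
noncomputable def Link.chain (l : Link.{u, v, x} L) : ℕ → Link.{u, v, x} L
  | 0 => l
  | i + 1 => (l.chain i).next

/-- If `inc` and `mv` are elementary maps from `M` to `N`, then some elementary extension of `N`
has an elementary self-map which moves `inc m` to `mv m`. -/
theorem exists_elementary_endomorphism (l : Link.{u, v, x} L) :
    ∃ (P : Type x) (_ : L.Structure P) (j : l.N ↪ₑ[L] P) (τ : P ↪ₑ[L] P),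
      ∀ m, τ (j (l.inc m)) = j (l.mv m) := by
  let G : ℕ → Type x := fun i => (l.chain i).M
  let inc : ∀ i, G i ↪ₑ[L] G (i + 1) := fun i => (l.chain i).inc
  let mv : ∀ i, G i ↪ₑ[L] G (i + 1) := fun i => (l.chain i).mv
  have hcomm : ∀ i m, inc (i + 1) (mv i m) = mv (i + 1) (inc i m) :=
    fun i m => (l.chain i).next_inc_mv m
  let F := DirectedSystem.natLERec fun i => (inc i).toEmbedding
  let P := FirstOrder.Language.DirectLimit G F
  let of : ∀ i, G i ↪[L] P := DirectLimit.of L ℕ G F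
  have hof : ∀ i m, of (i + 1) (inc i m) = of i m := fun i m => by
    have h1 : F i (i + 1) i.le_succ m = inc i m := by
      simp only [F, DirectedSystem.coe_natLERec]
      exact Nat.leRecOn_succ' m
    rw [← h1]
    exact DirectLimit.of_f
  have hF : ∀ i j (hij : i ≤ j) m,
      of (j + 1) (mv j (F i j hij m)) = of (i + 1) (mv i m) := by
    intro i j hij m
    induction j, hij using Nat.le_induction with
    | base => 
      have : F i i le_rfl m = m := by simp [F, Nat.leRecOn_self]
      rw [this]
    | succ j hij ih =>
      have : F i (j + 1) (hij.trans j.le_succ) m = inc j (F i j hij m) := by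
        simp [F, Nat.leRecOn_succ hij]
      rw [this, ← hcomm, hof, ih]
  let τ : P ↪[L] P := FirstOrder.Language.DirectLimit.lift L ℕ G F (fun i => (of (i + 1)).comp (mv i).toEmbedding) hF
  have hτ : ∀ i m, τ (of i m) = of (i + 1) (mv i m) := fun i m => FirstOrder.Language.DirectLimit.lift_of _ _ m
  have hreal : ∀ {n} (φ : L.Formula (Fin n)) i (a : Fin n → G i),
      φ.Realize (of i ∘ a) ↔ φ.Realize a := fun φ i a => by
    have := realize_directLimit_of inc φ i a default
    rwa [Subsingleton.elim (_ ∘ default) default] at this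
  refine ⟨P, inferInstance, ⟨of 1, fun n φ a => hreal φ 1 a⟩, ⟨τ, fun n φ a => ?_⟩, fun m => ?_⟩
  · obtain ⟨i, b, rfl⟩ := DirectLimit.exists_quotient_mk'_sigma_mk'_eq G F a
    have h1 : τ ∘ (of i ∘ b) = of (i + 1) ∘ (mv i ∘ b) := funext fun k => hτ i (b k)
    change φ.Realize (τ ∘ (of i ∘ b)) ↔ φ.Realize (of i ∘ b)
    rw [h1, hreal, hreal, (mv i).map_formula]
  · exact (congrArg τ (hof 0 m)).trans (hτ 0 m)

end Chain

/-! ### Definable sets in elementary extensions -/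

section Formulas

variable {L : FirstOrder.Language.{u, v}} {M : Type x} {N : Type y} {ι κ : Type}

theorem mem_defSet [L.Structure M] {φ : ParamFormula L M ι} {a : ι → M} :
    a ∈ defSet φ ↔ φ.Realize (Sum.elim id a) := Iff.rfl

theorem mem_defSet_push [L.Structure N] {j : M → N} {φ : ParamFormula L M ι} {a : ι → N} :
    a ∈ defSet (push j φ) ↔ φ.Realize (Sum.elim j a) := by
  rw [mem_defSet, push, Formula.realize_relabel, Sum.elim_comp_map]
  rfl

@[simp]
theorem mem_defSet_inf [L.Structure M] {φ ψ : ParamFormula L M ι} {a : ι → M} :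
    a ∈ defSet (φ ⊓ ψ : L.Formula _) ↔ a ∈ defSet φ ∧ a ∈ defSet ψ := Formula.realize_inf

@[simp]
theorem mem_defSet_sup [L.Structure M] {φ ψ : ParamFormula L M ι} {a : ι → M} :
    a ∈ defSet (φ ⊔ ψ : L.Formula _) ↔ a ∈ defSet φ ∨ a ∈ defSet ψ := Formula.realize_sup

@[simp]
theorem mem_defSet_not [L.Structure M] {φ : ParamFormula L M ι} {a : ι → M} :
    a ∈ defSet (Formula.not φ) ↔ a ∉ defSet φ := Formula.realize_not

@[simp]
theorem defSet_bot [L.Structure M] : defSet (⊥ : L.Formula (M ⊕ ι)) = ∅ :=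
  Set.eq_empty_of_forall_notMem fun _ => id

/-- The formula `∃ x, X(x) ∧ G(x, y)`. -/
noncomputable def imageFormula [Finite ι] (G : ParamFormula L M (ι ⊕ κ)) (X : ParamFormula L M ι) :
    ParamFormula L M κ :=
  Formula.iExs ι
    ((X.relabel (Sum.map Sum.inl id : M ⊕ ι → (M ⊕ κ) ⊕ ι)) ⊓
      (G.relabel (Sum.elim (Sum.inl ∘ Sum.inl) (Sum.elim Sum.inr (Sum.inl ∘ Sum.inr)) :
        M ⊕ (ι ⊕ κ) → (M ⊕ κ) ⊕ ι)) : L.Formula _)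

theorem realize_imageFormula [Finite ι] [L.Structure N] {G : ParamFormula L M (ι ⊕ κ)}
    {X : ParamFormula L M ι} {p : M → N} {b : κ → N} :
    (imageFormula G X).Realize (Sum.elim p b) ↔
      ∃ a : ι → N, X.Realize (Sum.elim p a) ∧ G.Realize (Sum.elim p (Sum.elim a b)) := by
  rw [imageFormula, Formula.realize_iExs]
  refine exists_congr fun a => ?_
  rw [Formula.realize_inf, Formula.realize_relabel, Formula.realize_relabel]
  refine and_congr (iff_of_eq (congrArg _ ?_)) (iff_of_eq (congrArg _ ?_))
  · ext (i | i) <;> rfl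
  · ext (i | i | i) <;> rfl

theorem mem_defSet_imageFormula [Finite ι] [L.Structure M] {G : ParamFormula L M (ι ⊕ κ)}
    {X : ParamFormula L M ι} {b : κ → M} :
    b ∈ defSet (imageFormula G X) ↔ ∃ a ∈ defSet X, Sum.elim a b ∈ defSet G :=
  realize_imageFormula

/-- The converse of the relation defined by `G`. -/
def swapFormula (G : ParamFormula L M (ι ⊕ κ)) : ParamFormula L M (κ ⊕ ι) :=
  G.relabel (Sum.map id Sum.swap)

theorem mem_defSet_swapFormula [L.Structure M] {G : ParamFormula L M (ι ⊕ κ)} {a : ι → M}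
    {b : κ → M} : Sum.elim b a ∈ defSet (swapFormula G) ↔ Sum.elim a b ∈ defSet G := by
  rw [mem_defSet, swapFormula, Formula.realize_relabel, mem_defSet]
  refine iff_of_eq (congrArg _ ?_)
  ext (i | i | i) <;> rfl

/-- The formula with free variables `x₀, …, xₖ, y` saying that not all `xᵢ` are distinct elements
of the fibre `{x ∈ X | G(x, y)}`. -/
noncomputable def fibreFormula [Finite ι] (G : ParamFormula L M (ι ⊕ κ)) (X : ParamFormula L M ι)
    (k : ℕ) : ParamFormula L M ((Fin (k + 1) × ι) ⊕ κ) :=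
  Formula.imp
    (Formula.iInf fun i : Fin (k + 1) =>
      ((X.relabel (Sum.map id fun c => Sum.inl (i, c))) ⊓
        (G.relabel (Sum.map id (Sum.map (fun c => (i, c)) id))) : L.Formula _))
    (Formula.iSup fun p : {p : Fin (k + 1) × Fin (k + 1) // p.1 ≠ p.2} =>
      Formula.iInf fun c : ι => Term.equal (Term.var (Sum.inr (Sum.inl (p.1.1, c))))
        (Term.var (Sum.inr (Sum.inl (p.1.2, c)))))

theorem realize_fibreFormula [Finite ι] [L.Structure N] {G : ParamFormula L M (ι ⊕ κ)} {X : ParamFormula L M ι}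
    {k : ℕ} {p : M → N} {s : Fin (k + 1) → ι → N} {b : κ → N} :
    (fibreFormula G X k).Realize (Sum.elim p (Sum.elim (fun c => s c.1 c.2) b)) ↔
      ((∀ i, X.Realize (Sum.elim p (s i)) ∧ G.Realize (Sum.elim p (Sum.elim (s i) b))) →
        ∃ i i', i ≠ i' ∧ s i = s i') := by
  rw [fibreFormula, Formula.realize_imp, Formula.realize_iInf, Formula.realize_iSup]
  refine imp_congr (forall_congr' fun i => ?_) ?_
  · rw [Formula.realize_inf, Formula.realize_relabel, Formula.realize_relabel]
    refine and_congr (iff_of_eq (congrArg _ ?_)) (iff_of_eq (congrArg _ ?_))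
    · ext (i | i) <;> rfl
    · ext (i | i | i) <;> rfl
  · simp [Formula.realize_iInf, Formula.realize_equal, funext_iff]

variable [L.Structure M] [L.Structure N]

theorem forall_realize_iff [Finite ι] (j : M ↪ₑ[L] N) (φ : ParamFormula L M ι) :
    (∀ a : ι → N, φ.Realize (Sum.elim j a)) ↔ ∀ a : ι → M, φ.Realize (Sum.elim id a) := by
  rw [← Formula.realize_iAlls, ← Formula.realize_iAlls]
  exact j.map_formula _ id

theorem push_subset_push [Finite ι] (j : M ↪ₑ[L] N) {φ ψ : ParamFormula L M ι}
    (h : defSet φ ⊆ defSet ψ) : defSet (push j φ) ⊆ defSet (push j ψ) := fun a ha =>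
  mem_defSet_push.2 ((forall_realize_iff j (φ.imp ψ)).2
    (fun _ => Formula.realize_imp.2 fun hb => h hb) a (mem_defSet_push.1 ha))

theorem push_disjoint_push [Finite ι] (j : M ↪ₑ[L] N) {φ ψ : ParamFormula L M ι}
    (h : Disjoint (defSet φ) (defSet ψ)) : Disjoint (defSet (push j φ)) (defSet (push j ψ)) :=
  Set.disjoint_left.2 fun a ha hb =>
    (forall_realize_iff j (φ.imp ψ.not)).2
      (fun _ => Formula.realize_imp.2 fun h1 => Formula.realize_not.2 fun h2 =>
        Set.disjoint_left.1 h h1 h2) a (mem_defSet_push.1 ha) (mem_defSet_push.1 hb)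

theorem push_nonempty_iff [Finite ι] (j : M ↪ₑ[L] N) {φ : ParamFormula L M ι} :
    (defSet (push j φ)).Nonempty ↔ (defSet φ).Nonempty := by
  have := not_congr (forall_realize_iff j φ.not)
  simp only [Formula.realize_not, not_forall, not_not] at this
  exact (exists_congr fun _ => mem_defSet_push).trans this

theorem defSet_push_push {P : Type*} [L.Structure P] (j : M ↪ₑ[L] N) (k : N ↪ₑ[L] P)
    (φ : ParamFormula L M ι) : defSet (push k (push j φ)) = defSet (push (k.comp j) φ) := by
  ext a
  rw [mem_defSet_push, mem_defSet_push, push, Formula.realize_relabel]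
  refine iff_of_eq (congrArg _ ?_)
  ext (i | i) <;> rfl

theorem defSet_push_refl (φ : ParamFormula L M ι) :
    defSet (push (ElementaryEmbedding.refl L M) φ) = defSet φ := by
  ext a
  rw [mem_defSet_push]
  rfl

/-- Elementary extensions preserve the bound on the size of the fibres of a relation. -/
theorem push_fibres [Finite ι] [Finite κ] (j : M ↪ₑ[L] N) {G : ParamFormula L M (ι ⊕ κ)}
    {X : ParamFormula L M ι} {k : ℕ}
    (h : ∀ (b : κ → M) (s : Fin (k + 1) → ι → M),
      (∀ i, s i ∈ defSet X ∧ Sum.elim (s i) b ∈ defSet G) → ∃ i i', i ≠ i' ∧ s i = s i')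
    (b : κ → N) (s : Fin (k + 1) → ι → N)
    (hs : ∀ i, s i ∈ defSet (push j X) ∧ Sum.elim (s i) b ∈ defSet (push j G)) :
    ∃ i i', i ≠ i' ∧ s i = s i' := by
  have := (forall_realize_iff j (fibreFormula G X k)).2 fun a => by
    have := (realize_fibreFormula (p := id)).2 (h (a ∘ Sum.inr) fun i c => a (Sum.inl (i, c)))
    convert this using 2
    ext (c | c) <;> rfl
  exact realize_fibreFormula.1 (this (Sum.elim (fun c => s c.1 c.2) b)) fun i =>
    (hs i).imp mem_defSet_push.1 mem_defSet_push.1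

end Formulas

/-! ### Morley rank -/

section Rank

variable {L : FirstOrder.Language.{u, v}} {M N : Type x} [L.Structure M] [L.Structure N]
  {ι κ : Type}

theorem morleyRankGE_iff {α : Ordinal.{x}} {φ : ParamFormula L M ι} :
    MorleyRankGE α M φ ↔ (defSet φ).Nonempty ∧ ∀ β : Ordinal.{x}, β < α →
      ∃ (N : Type x) (_ : L.Structure N) (j : M ↪ₑ[L] N) (ψ : ℕ → ParamFormula L N ι),
        (∀ i, defSet (ψ i) ⊆ defSet (push j φ)) ∧
        (∀ i k, i ≠ k → Disjoint (defSet (ψ i)) (defSet (ψ k))) ∧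
        ∀ i, MorleyRankGE β N (ψ i) := by
  rw [MorleyRankGE]

theorem MorleyRankGE.nonempty {α : Ordinal.{x}} {φ : ParamFormula L M ι}
    (h : MorleyRankGE α M φ) : (defSet φ).Nonempty := (morleyRankGE_iff.1 h).1

theorem MorleyRankGE.of_le {α β : Ordinal.{x}} {φ : ParamFormula L M ι}
    (h : MorleyRankGE α M φ) (hβ : β ≤ α) : MorleyRankGE β M φ :=
  morleyRankGE_iff.2 ⟨h.nonempty, fun γ hγ => (morleyRankGE_iff.1 h).2 γ (hγ.trans_le hβ)⟩

theorem MorleyRankGE.mono [Finite ι] {α : Ordinal.{x}} {φ ψ : ParamFormula L M ι}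
    (h : MorleyRankGE α M φ) (hφ : defSet φ ⊆ defSet ψ) : MorleyRankGE α M ψ := by
  refine morleyRankGE_iff.2 ⟨h.nonempty.mono hφ, fun γ hγ => ?_⟩
  obtain ⟨N, _, j, χ, h1, h2, h3⟩ := (morleyRankGE_iff.1 h).2 γ hγ
  exact ⟨N, _, j, χ, fun i => (h1 i).trans (push_subset_push j hφ), h2, h3⟩

/-- Morley rank is invariant under elementary maps. -/
theorem morleyRankGE_push_iff [Finite ι] [Nonempty M] {α : Ordinal.{x}} (j : M ↪ₑ[L] N)
    {φ : ParamFormula L M ι} : MorleyRankGE α N (push j φ) ↔ MorleyRankGE α M φ := by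
  constructor
  · intro h
    refine morleyRankGE_iff.2 ⟨(push_nonempty_iff j).1 h.nonempty, fun γ hγ => ?_⟩
    obtain ⟨P, _, k, χ, h1, h2, h3⟩ := (morleyRankGE_iff.1 h).2 γ hγ
    exact ⟨P, _, k.comp j, χ, fun i => (h1 i).trans (defSet_push_push j k φ).subset, h2, h3⟩
  · intro h
    induction α using WellFoundedLT.induction generalizing M N with
    | ind α ih =>
    refine morleyRankGE_iff.2 ⟨(push_nonempty_iff j).2 h.nonempty, fun γ hγ => ?_⟩
    obtain ⟨N', _, i, χ, h1, h2, h3⟩ := (morleyRankGE_iff.1 h).2 γ hγ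
    have : Nonempty N := ‹Nonempty M›.map j
    have : Nonempty N' := ‹Nonempty M›.map i
    obtain ⟨P, _, q, p, hpq⟩ := exists_amalgam_over j i
    refine ⟨P, _, q, fun c => push p (χ c), fun c => ?_,
      fun c d hcd => push_disjoint_push p (h2 c d hcd), fun c => ih γ hγ p (h3 c)⟩
    refine (push_subset_push p (h1 c)).trans ?_
    rw [defSet_push_push, defSet_push_push]
    have : q.comp j = p.comp i := ElementaryEmbedding.ext hpq
    rw [this]

/-- The Morley rank of a union is the maximum of the two ranks. -/
theorem MorleyRankGE.of_sup [Finite ι] {α : Ordinal.{x}} {φ ψ : ParamFormula L M ι}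
    (h : MorleyRankGE α M (φ ⊔ ψ : L.Formula _)) : MorleyRankGE α M φ ∨ MorleyRankGE α M ψ := by
  induction α using WellFoundedLT.induction generalizing M with
  | ind α ih =>
  by_contra! hcon
  obtain ⟨hφ, hψ⟩ := hcon
  rw [morleyRankGE_iff, not_and_or] at hφ hψ
  rcases hφ with hφ | hφ
  · have hφ : defSet φ = ∅ := Set.not_nonempty_iff_eq_empty.1 hφ
    have : MorleyRankGE α M ψ := h.mono fun a ha => by
      rcases mem_defSet_sup.1 ha with ha | ha
      · exact absurd ha (by simp [hφ])
      · exact ha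
    rw [morleyRankGE_iff] at this
    tauto
  rcases hψ with hψ | hψ
  · have hψ : defSet ψ = ∅ := Set.not_nonempty_iff_eq_empty.1 hψ
    have : MorleyRankGE α M φ := h.mono fun a ha => by
      rcases mem_defSet_sup.1 ha with ha | ha
      · exact ha
      · exact absurd ha (by simp [hψ])
    rw [morleyRankGE_iff] at this
    tauto
  push Not at hφ hψ
  obtain ⟨β, hβ, hφ⟩ := hφ
  obtain ⟨γ, hγ, hψ⟩ := hψ
  obtain ⟨N, _, j, χ, h1, h2, h3⟩ := (morleyRankGE_iff.1 h).2 (max β γ) (max_lt hβ hγ)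
  have hsplit : ∀ i, MorleyRankGE (max β γ) N (χ i ⊓ push j φ : L.Formula _) ∨
      MorleyRankGE (max β γ) N (χ i ⊓ push j ψ : L.Formula _) := fun i =>
    ih _ (max_lt hβ hγ) ((h3 i).mono fun a ha => by
      have := h1 i ha
      rw [mem_defSet_push, Formula.realize_sup, ← mem_defSet_push, ← mem_defSet_push] at this
      simpa [ha] using this)
  have hinf : {i | MorleyRankGE (max β γ) N (χ i ⊓ push j φ : L.Formula _)}.Infinite ∨
      {i | MorleyRankGE (max β γ) N (χ i ⊓ push j ψ : L.Formula _)}.Infinite := by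
    rw [← Set.infinite_union]
    convert Set.infinite_univ (α := ℕ)
    exact Set.eq_univ_of_forall hsplit
  rcases hinf with hinf | hinf
  · let e := hinf.natEmbedding
    obtain ⟨i, hi⟩ := hφ N _ j (fun i => (χ (e i) ⊓ push j φ : L.Formula _))
      (fun i a ha => (mem_defSet_inf.1 ha).2)
      (fun i k hik => (h2 (e i) (e k) (fun h => hik (e.injective (Subtype.ext h)))).mono
        (fun a ha => (mem_defSet_inf.1 ha).1) (fun a ha => (mem_defSet_inf.1 ha).1))
    exact hi (MorleyRankGE.of_le (e i).2 (le_max_left _ _))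
  · let e := hinf.natEmbedding
    obtain ⟨i, hi⟩ := hψ N _ j (fun i => (χ (e i) ⊓ push j ψ : L.Formula _))
      (fun i a ha => (mem_defSet_inf.1 ha).2)
      (fun i k hik => (h2 (e i) (e k) (fun h => hik (e.injective (Subtype.ext h)))).mono
        (fun a ha => (mem_defSet_inf.1 ha).1) (fun a ha => (mem_defSet_inf.1 ha).1))
    exact hi (MorleyRankGE.of_le (e i).2 (le_max_right _ _))

/-- The sets covered by a definable set of Morley rank less than `α`. They form an ideal. -/
def IsSmall (L : FirstOrder.Language.{u, v}) {M : Type x} [L.Structure M] (α : Ordinal.{x})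
    (S : Set (ι → M)) : Prop :=
  ∃ φ : ParamFormula L M ι, ¬ MorleyRankGE α M φ ∧ S ⊆ defSet φ

theorem isSmall_defSet_iff [Finite ι] {α : Ordinal.{x}} {φ : ParamFormula L M ι} :
    IsSmall L α (defSet φ) ↔ ¬ MorleyRankGE α M φ :=
  ⟨fun ⟨_, h1, h2⟩ h => h1 (h.mono h2), fun h => ⟨φ, h, subset_rfl⟩⟩

theorem IsSmall.mono {α : Ordinal.{x}} {S S' : Set (ι → M)} (h : IsSmall L α S')
    (hS : S ⊆ S') : IsSmall L α S :=
  h.imp fun _ h => ⟨h.1, hS.trans h.2⟩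

theorem isSmall_empty {α : Ordinal.{x}} : IsSmall L α (∅ : Set (ι → M)) :=
  ⟨⊥, fun h => by simpa using h.nonempty, Set.empty_subset _⟩

theorem IsSmall.union [Finite ι] {α : Ordinal.{x}} {S S' : Set (ι → M)} (h : IsSmall L α S)
    (h' : IsSmall L α S') : IsSmall L α (S ∪ S') := by
  obtain ⟨φ, h1, h2⟩ := h
  obtain ⟨φ', h1', h2'⟩ := h'
  exact ⟨(φ ⊔ φ' : L.Formula _), fun h => h.of_sup.elim h1 h1',
    Set.union_subset (fun a ha => mem_defSet_sup.2 (.inl (h2 ha)))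
      (fun a ha => mem_defSet_sup.2 (.inr (h2' ha)))⟩

theorem IsSmall.biUnion [Finite ι] {α : Ordinal.{x}} {τ : Type*} {t : Finset τ}
    {S : τ → Set (ι → M)} (h : ∀ i ∈ t, IsSmall L α (S i)) : IsSmall L α (⋃ i ∈ t, S i) := by
  classical
  induction t using Finset.induction_on with
  | empty => simpa using isSmall_empty
  | insert i t hi ih =>
    rw [Finset.set_biUnion_insert]
    exact (h i (Finset.mem_insert_self i t)).union
      (ih fun j hj => h j (Finset.mem_insert_of_mem hj))

/-- If infinitely many definable sets have rank at least `β` and no `k + 1` of them have a common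
point, then they can be shrunk to infinitely many pairwise disjoint sets of rank at least `β`. -/
theorem exists_disjoint_family [Finite ι] {β : Ordinal.{x}} (k : ℕ) (X : ℕ → ParamFormula L M ι)
    (hX : ∀ i, MorleyRankGE β M (X i))
    (hk : ∀ s : Fin (k + 1) → ℕ, Function.Injective s → ∀ a, ∃ i, a ∉ defSet (X (s i))) :
    ∃ Z : ℕ → ParamFormula L M ι, (∀ i, MorleyRankGE β M (Z i)) ∧
      (∀ i, ∃ c, defSet (Z i) ⊆ defSet (X c)) ∧
      ∀ i j, i ≠ j → Disjoint (defSet (Z i)) (defSet (Z j)) := by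
  induction k generalizing X with
  | zero =>
    obtain ⟨a, ha⟩ := (hX 0).nonempty
    obtain ⟨i, hi⟩ := hk (fun _ => 0) (fun i j _ => Fin.ext (by omega)) a
    exact absurd ha hi
  | succ k ih =>
    by_cases hinf : ∃ c, {i | MorleyRankGE β M (X c ⊓ X i : L.Formula _)}.Infinite
    · -- Many members meet `X c` in a large set: inside `X c` one intersection has been used up.
      obtain ⟨c, hc⟩ := hinf
      have hc' := hc.sdiff (Set.finite_singleton c)
      let e := hc'.natEmbedding
      obtain ⟨Z, hZ, hZX, hd⟩ := ih (fun i => (X c ⊓ X (e i) : L.Formula _)) (fun i => (e i).2.1)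
        fun s hs a => by
          by_contra! hcon
          have hinj : Function.Injective (Fin.cons c fun i => (e (s i) : ℕ) : Fin (k + 2) → ℕ) := by
            rw [Fin.cons_injective_iff]
            refine ⟨fun ⟨i, hi⟩ => (e (s i)).2.2 hi, fun i i' hi => hs (e.injective ?_)⟩
            exact Subtype.ext hi
          obtain ⟨i, hi⟩ := hk _ hinj a
          refine i.cases (motive := fun i => a ∉ defSet (X ((Fin.cons c fun i => (e (s i) : ℕ) :
            Fin (k + 2) → ℕ) i)) → False) ?_ (fun i hi => ?_) hi
          · exact fun h => h (mem_defSet_inf.1 (hcon 0)).1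
          · exact hi (mem_defSet_inf.1 (hcon i)).2
      refine ⟨Z, hZ, fun i => ?_, hd⟩
      obtain ⟨d, hd⟩ := hZX i
      exact ⟨e d, hd.trans fun a ha => (mem_defSet_inf.1 ha).2⟩
    · -- Otherwise a subsequence has pairwise small intersections, which can be removed.
      push Not at hinf
      obtain ⟨e, -, he⟩ := exists_seq_of_forall_finset_exists (fun _ : ℕ => True)
        (fun c i => ¬ MorleyRankGE β M (X c ⊓ X i : L.Formula _)) fun s _ => by
          have hfin : (⋃ c ∈ s, {i | MorleyRankGE β M (X c ⊓ X i : L.Formula _)}).Finite :=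
            s.finite_toSet.biUnion fun c _ => hinf c
          obtain ⟨i, hi⟩ := hfin.exists_notMem
          simp only [Set.mem_iUnion, not_exists] at hi
          exact ⟨i, trivial, fun c hc => hi c hc⟩
      let Z : ℕ → ParamFormula L M ι := fun b =>
        (X (e b) ⊓ Formula.not (Formula.iSup fun a : Fin b => X (e a)) : L.Formula _)
      have hZ : ∀ b a, a ∈ defSet (Z b) ↔ a ∈ defSet (X (e b)) ∧ ∀ c < b, a ∉ defSet (X (e c)) := by
        intro b a
        simp only [Z, mem_defSet_inf, mem_defSet_not]
        refine and_congr_right fun _ => ?_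
        rw [mem_defSet, Formula.realize_iSup, not_exists]
        exact ⟨fun h c hc => h ⟨c, hc⟩, fun h c => h c c.2⟩
      refine ⟨Z, fun b => ?_, fun b => ⟨e b, fun a ha => ((hZ b a).1 ha).1⟩, ?_⟩
      · by_contra hsmall
        have h1 : IsSmall L β (⋃ c ∈ Finset.range b,
            defSet (X (e c) ⊓ X (e b) : L.Formula _)) :=
          IsSmall.biUnion fun c hc => isSmall_defSet_iff.2 (he c b (Finset.mem_range.1 hc))
        refine isSmall_defSet_iff.1 (((isSmall_defSet_iff.2 hsmall).union h1).mono ?_) (hX (e b))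
        intro a ha
        by_cases hc : ∃ c < b, a ∈ defSet (X (e c))
        · obtain ⟨c, hc, hac⟩ := hc
          exact .inr (Set.mem_biUnion (Finset.mem_range.2 hc) (mem_defSet_inf.2 ⟨hac, ha⟩))
        · push Not at hc
          exact .inl ((hZ b a).2 ⟨ha, hc⟩)
      · have hlt : ∀ i j, i < j → Disjoint (defSet (Z i)) (defSet (Z j)) := fun i j hij =>
          Set.disjoint_left.2 fun a hi hj => ((hZ j a).1 hj).2 i hij ((hZ i a).1 hi).1
        exact fun i j hij => hij.lt_or_gt.elim (hlt i j) fun h => (hlt j i h).symm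

/-- A definable relation from `X` to `Y` which is total on `X` and whose fibres over `Y` have at
most `k` elements does not decrease the Morley rank. -/
theorem MorleyRankGE.of_fibres [Finite ι] [Finite κ] {α : Ordinal.{x}}
    {k : ℕ} {G : ParamFormula L M (ι ⊕ κ)} {X : ParamFormula L M ι} {Y : ParamFormula L M κ}
    (hX : MorleyRankGE α M X) (htot : ∀ a ∈ defSet X, ∃ b ∈ defSet Y, Sum.elim a b ∈ defSet G)
    (hfib : ∀ (b : κ → M) (s : Fin (k + 1) → ι → M),
      (∀ i, s i ∈ defSet X ∧ Sum.elim (s i) b ∈ defSet G) → ∃ i i', i ≠ i' ∧ s i = s i') :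
    MorleyRankGE α M Y := by
  induction α using WellFoundedLT.induction generalizing M with
  | ind α ih =>
  refine morleyRankGE_iff.2 ⟨?_, fun β hβ => ?_⟩
  · obtain ⟨a, ha⟩ := hX.nonempty
    obtain ⟨b, hb, -⟩ := htot a ha
    exact ⟨b, hb⟩
  obtain ⟨N, _, j, χ, h1, h2, h3⟩ := (morleyRankGE_iff.1 hX).2 β hβ
  have hfib' := push_fibres j hfib
  have htot' : defSet (push j X) ⊆ defSet (push j (imageFormula (swapFormula G) Y)) :=
    push_subset_push j fun a ha => by
      obtain ⟨b, hb, hab⟩ := htot a ha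
      exact mem_defSet_imageFormula.2 ⟨b, hb, mem_defSet_swapFormula.2 hab⟩
  have htot'' : ∀ a ∈ defSet (push j X), ∃ b ∈ defSet (push j Y),
      Sum.elim a b ∈ defSet (push j G) := fun a ha => by
    obtain ⟨b, hb, hab⟩ := realize_imageFormula.1 (mem_defSet_push.1 (htot' ha))
    refine ⟨b, mem_defSet_push.2 hb, mem_defSet_push.2 ?_⟩
    rw [swapFormula, Formula.realize_relabel] at hab
    convert hab using 2
    ext (i | i | i) <;> rfl
  let W : ℕ → ParamFormula L N κ := fun i =>
    (push j Y ⊓ imageFormula (push j G) (χ i) : L.Formula _)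
  have hW : ∀ i b, b ∈ defSet (W i) ↔
      b ∈ defSet (push j Y) ∧ ∃ a ∈ defSet (χ i), Sum.elim a b ∈ defSet (push j G) := fun i b => by
    rw [← mem_defSet_imageFormula]
    exact mem_defSet_inf
  obtain ⟨Z, hZ, hZW, hd⟩ := exists_disjoint_family k W
    (fun i => ih β hβ (h3 i)
      (fun a ha => by
        obtain ⟨b, hb, hab⟩ := htot'' a (h1 i ha)
        exact ⟨b, (hW i b).2 ⟨hb, a, ha, hab⟩, hab⟩)
      fun b s hs => hfib' b s fun i' => ⟨h1 i (hs i').1, (hs i').2⟩)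
    (fun s hs b => by
      by_contra! hcon
      choose c hc hcb using fun i => ((hW _ b).1 (hcon i)).2
      obtain ⟨i, i', hne, heq⟩ := hfib' b c fun i => ⟨h1 _ (hc i), hcb i⟩
      exact Set.disjoint_left.1 (h2 (s i) (s i') (hs.ne hne)) (hc i) (heq ▸ hc i'))
  refine ⟨N, _, j, Z, fun i => ?_, hd, hZ⟩
  obtain ⟨c, hc⟩ := hZW i
  exact hc.trans fun b hb => ((hW c b).1 hb).1

end Rank

/-! ### Finite dominant rational functions -/

section RationalFunctions

variable {L : FirstOrder.Language.{u, v}} {E : Type x} [L.Structure E] {ι κ : Type}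

/-- In an irreducible set of rank `β`, a definable subset or its complement has smaller rank. -/
theorem isSmall_diff_of_not_morleyDegreeGE [Finite ι] {β : Ordinal.{x}} {B X : ParamFormula L E ι}
    (hB : ¬ MorleyDegreeGE β 2 E B) (hX : defSet X ⊆ defSet B) (hXβ : MorleyRankGE β E X) :
    IsSmall L β (defSet B \ defSet X) := by
  refine ⟨(B ⊓ Formula.not X : L.Formula _), fun h => hB ?_,
    fun a ha => mem_defSet_inf.2 ⟨ha.1, mem_defSet_not.2 ha.2⟩⟩
  have hdis : Disjoint (defSet X) (defSet (B ⊓ Formula.not X : L.Formula _)) :=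
    Set.disjoint_left.2 fun a h1 h2 => mem_defSet_not.1 (mem_defSet_inf.1 h2).2 h1
  refine ⟨E, _, ElementaryEmbedding.refl L E, ![X, (B ⊓ Formula.not X : L.Formula _)], ?_, ?_, ?_⟩
  · rw [defSet_push_refl, Fin.forall_fin_two]
    exact ⟨hX, fun a ha => (mem_defSet_inf.1 ha).1⟩
  · simp only [Fin.forall_fin_two]
    exact ⟨⟨fun h => absurd rfl h, fun _ => hdis⟩, fun _ => hdis.symm, fun h => absurd rfl h⟩
  · rw [Fin.forall_fin_two]
    exact ⟨hXβ, h⟩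

/-- A definable Zariski-dense subset has full rank. -/
theorem ZariskiDense.morleyRankGE {α : Ordinal.{x}} {A C : ParamFormula L E ι}
    (h : ZariskiDense (defSet C) A) (hA : MorleyRankGE α E A) : MorleyRankGE α E C :=
  by_contra fun hC => h.2 C h.1 ⟨α, hA, hC⟩ subset_rfl

namespace RationalFunction

variable {B : ParamFormula L E ι} {A : ParamFormula L E κ} (f : RationalFunction B A)

theorem Maps.mem_source {f : RationalFunction B A} {b : ι → E} {a : κ → E} (h : f.Maps b a) :
    b ∈ defSet B := f.dense_domain.1 ⟨a, h⟩

/-- The complement of the domain of a rational function is small. -/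
theorem isSmall_diff_domain [Finite ι] [Finite κ] {β : Ordinal.{x}} (hβ : MorleyRankGE β E B)
    (hB : ¬ MorleyDegreeGE β 2 E B) : IsSmall L β (defSet B \ {b | ∃ a, f.Maps b a}) := by
  have hdom : {b | ∃ a, f.Maps b a} = defSet (imageFormula (swapFormula f.graph) A) := by
    ext b
    rw [mem_defSet_imageFormula]
    exact exists_congr fun a => ⟨fun h => ⟨f.maps_to b a h, mem_defSet_swapFormula.2 h⟩,
      fun h => mem_defSet_swapFormula.1 h.2⟩
  have h := f.dense_domain
  change ZariskiDense {b | ∃ a, f.Maps b a} B at h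
  rw [hdom] at h ⊢
  exact isSmall_diff_of_not_morleyDegreeGE hB h.1 (h.morleyRankGE hβ)

/-- The rank of the target of a dominant rational function is at most the rank of the source. -/
theorem IsDominant.morleyRankGE [Finite ι] [Finite κ] {f : RationalFunction B A}
    (hf : f.IsDominant) {α : Ordinal.{x}} (hα : MorleyRankGE α E A) : MorleyRankGE α E B := by
  have himg : {a | ∃ b, f.Maps b a} = defSet (imageFormula f.graph B) := by
    ext a
    rw [mem_defSet_imageFormula]
    exact exists_congr fun b => ⟨fun h => ⟨h.mem_source, h⟩, fun h => h.2⟩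
  rw [IsDominant, himg] at hf
  -- The converse of the graph of `f` is a relation whose fibres have at most one element.
  refine (hf.morleyRankGE hα).of_fibres (k := 1) (G := swapFormula f.graph) ?_ ?_
  · intro a ha
    obtain ⟨b, hb, hab⟩ := mem_defSet_imageFormula.1 ha
    exact ⟨b, hb, mem_defSet_swapFormula.2 hab⟩
  · intro b s hs
    exact ⟨0, 1, by simp, f.functional b _ _ (mem_defSet_swapFormula.1 (hs 0).2)
      (mem_defSet_swapFormula.1 (hs 1).2)⟩

/-- The preimage of a definable set of smaller rank under a finite dominant rational function on an
irreducible set has smaller rank. -/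
theorem isSmall_preimage [Finite ι] [Finite κ] (hf : f.IsFinite) (hf' : f.IsDominant)
    {α β : Ordinal.{x}} (hβ : MorleyRankEq β E B) (hB : ¬ MorleyDegreeGE β 2 E B)
    (hα : MorleyRankGE α E A) {C : ParamFormula L E κ} (hC : ¬ MorleyRankGE α E C) :
    IsSmall L β {b | ∃ a ∈ defSet C, f.Maps b a} := by
  have hαβ : α ≤ β := by
    by_contra! h
    exact hβ.2 ((hf'.morleyRankGE hα).of_le (Order.succ_le_of_lt h))
  obtain ⟨k, φ, hφ, hrank⟩ := hf
  have hφB : defSet φ ⊆ defSet B := by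
    rw [hφ]
    rintro b ⟨a, hab, -⟩
    exact hab.mem_source
  have hpre : {b | ∃ a ∈ defSet C, f.Maps b a} =
      defSet (imageFormula (swapFormula f.graph) C) := by
    ext b
    simp only [mem_defSet_imageFormula, mem_defSet_swapFormula]
    rfl
  -- The part of the preimage lying in the locus where the fibres of `f` have exactly `k` elements.
  let X : ParamFormula L E ι := (imageFormula (swapFormula f.graph) C ⊓ φ : L.Formula _)
  have hX : ∀ b, b ∈ defSet X ↔ (∃ a ∈ defSet C, f.Maps b a) ∧ b ∈ defSet φ := fun b => by
    change b ∈ defSet (_ ⊓ _ : L.Formula _) ↔ _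
    rw [mem_defSet_inf, ← hpre]
    rfl
  have hXsmall : IsSmall L β (defSet X) := by
    rw [isSmall_defSet_iff]
    intro hXβ
    refine hC ((hXβ.of_fibres (k := k) (G := f.graph) (Y := C) ?_ ?_).of_le hαβ)
    · intro b hb
      exact ((hX b).1 hb).1
    · intro a s hs
      by_contra! hcon
      have hinj : Function.Injective s := fun i i' h => by_contra fun hne => hcon i i' hne h
      have h0 := ((hX _).1 (hs 0).1).2
      rw [hφ] at h0
      obtain ⟨a', ha', hcard⟩ := h0
      obtain rfl := f.functional _ _ _ ha' (hs 0).2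
      have h1 : Set.range s ⊆ {b | f.Maps b a'} := by
        rintro _ ⟨i, rfl⟩
        exact (hs i).2
      have h2 := (Set.encard_le_encard h1).trans_eq hcard
      rw [← Set.image_univ, hinj.encard_image, Set.encard_univ, ENat.card_eq_coe_fintype_card,
        Fintype.card_fin] at h2
      exact absurd (Nat.cast_le.1 h2) (by simp)
  refine (hXsmall.union (isSmall_diff_of_not_morleyDegreeGE hB hφB ((hrank β).2 hβ.1))).mono ?_
  intro b hb
  by_cases hbφ : b ∈ defSet φ
  · exact .inl ((hX b).2 ⟨hb, hbφ⟩)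
  · obtain ⟨a, -, hab⟩ := hb
    exact .inr ⟨hab.mem_source, hbφ⟩

end RationalFunction

end RationalFunctions

/-! ### Generic points -/

section GenericPoint

variable {L : FirstOrder.Language.{u, v}} {E : Type x} [L.Structure E] [Nonempty E] {ι κ : Type}

open Classical in
/-- A generic point `b` of `B` over `E`, together with its images `a` and `a'` under two finite
dominant rational functions: these are generic points of the two targets. The point `b` is the
class of the identity in an ultrapower of `E` indexed by `ι → E`. -/
theorem exists_generic_point [Finite ι] [Finite κ] {α β : Ordinal.{x}} {B : ParamFormula L E ι}
    {A A' : ParamFormula L E κ} (hβ : MorleyRankEq β E B) (hB : ¬ MorleyDegreeGE β 2 E B)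
    (hA : MorleyRankGE α E A) (hA' : MorleyRankGE α E A')
    (f : RationalFunction B A) (g : RationalFunction B A')
    (hf : f.IsFinite) (hf' : f.IsDominant) (hg : g.IsFinite) (hg' : g.IsDominant) :
    ∃ (P : Type x) (_ : L.Structure P) (j : E ↪ₑ[L] P) (b : ι → P) (a a' : κ → P),
      f.graph.Realize (Sum.elim j (Sum.elim b a)) ∧ g.graph.Realize (Sum.elim j (Sum.elim b a')) ∧
      A.Realize (Sum.elim j a) ∧ A'.Realize (Sum.elim j a') ∧
      (∀ C : ParamFormula L E κ, ¬ MorleyRankGE α E C → ¬ C.Realize (Sum.elim j a)) ∧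
      (∀ C : ParamFormula L E κ, ¬ MorleyRankGE α E C → ¬ C.Realize (Sum.elim j a')) := by
  let F : Filter (ι → E) :=
    { sets := {S | IsSmall L β (defSet B \ S)}
      univ_sets := isSmall_empty.mono (by simp)
      sets_of_superset := fun h hST => IsSmall.mono h (Set.sdiff_subset_sdiff_right hST)
      inter_sets := fun h h' => (IsSmall.union h h').mono (by rw [Set.sdiff_inter]) }
  have hF : F.NeBot := by
    refine ⟨fun h => ?_⟩
    have h0 : IsSmall L β (defSet B \ ∅) := by
      change ∅ ∈ F
      simp [h]
    rw [Set.sdiff_empty, isSmall_defSet_iff] at h0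
    exact h0 hβ.1
  let U : Ultrafilter (ι → E) := Ultrafilter.of F
  have hU : ∀ S : Set (ι → E), IsSmall L β (defSet B \ S) → S ∈ U :=
    fun S hS => Ultrafilter.of_le F hS
  have hU' : ∀ S : Set (ι → E), IsSmall L β S → Sᶜ ∈ U :=
    fun S hS => hU _ (hS.mono fun s hs => by simpa using hs.2)
  let P := (U : Filter (ι → E)).Product fun _ => E
  let j : E ↪ₑ[L] P :=
    { toFun := fun m => ((fun _ => m : (ι → E) → E) : P)
      map_formula' := fun n φ a => by
        refine (Ultraproduct.realize_formula_cast (u := U) φ fun i _ => a i).trans ?_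
        simp }
  let cls : {ν : Type} → ((ι → E) → ν → E) → ν → P :=
    fun h i => ((fun s => h s i : (ι → E) → E) : P)
  have hlos : ∀ {ν : Type} (h : (ι → E) → ν → E) (φ : ParamFormula L E ν),
      φ.Realize (Sum.elim j (cls h)) ↔ ∀ᶠ s : ι → E in (U : Filter (ι → E)), h s ∈ defSet φ := by
    intro ν h φ
    have h1 : (Sum.elim j (cls h) : E ⊕ ν → P) = fun i =>
        ((fun s => Sum.elim id (h s) i : (ι → E) → E) : P) := by
      ext (i | i) <;> rfl
    rw [h1]
    exact Ultraproduct.realize_formula_cast (u := U) φ fun i s => Sum.elim id (h s) i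
  have key : ∀ {A : ParamFormula L E κ} (_ : MorleyRankGE α E A) (f : RationalFunction B A)
      (_ : f.IsFinite) (_ : f.IsDominant), ∃ a : κ → P,
      f.graph.Realize (Sum.elim j (Sum.elim (cls id) a)) ∧ A.Realize (Sum.elim j a) ∧
      ∀ C : ParamFormula L E κ, ¬ MorleyRankGE α E C → ¬ C.Realize (Sum.elim j a) := by
    intro A hA f hf hf'
    let F : (ι → E) → κ → E := fun b =>
      if h : ∃ a, f.Maps b a then h.choose else fun _ => Classical.arbitrary E
    have hdom : ∀ᶠ b : ι → E in (U : Filter (ι → E)), f.Maps b (F b) := by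
      filter_upwards [hU _ (f.isSmall_diff_domain hβ.1 hB)] with b hb
      have hb : ∃ a, f.Maps b a := hb
      simp only [F, dif_pos hb]
      exact hb.choose_spec
    refine ⟨cls F, ?_, (hlos F A).2 (hdom.mono fun b hb => f.maps_to b _ hb), fun C hC hCa => ?_⟩
    · have h1 : (Sum.elim (cls id) (cls F) : ι ⊕ κ → P) = cls fun b => Sum.elim b (F b) := by
        ext (i | i) <;> rfl
      rw [h1]
      exact (hlos _ f.graph).2 hdom
    · have h1 := hU' _ (f.isSmall_preimage hf hf' hβ hB hA hC)
      obtain ⟨b, ⟨hb1, hb2⟩, hb3⟩ := ((((hlos F C).1 hCa).and hdom).and h1).exists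
      exact hb3 ⟨F b, hb1, hb2⟩
  obtain ⟨a, h1, h2, h3⟩ := key hA f hf hf'
  obtain ⟨a', h1', h2', h3'⟩ := key hA' g hg hg'
  exact ⟨P, inferInstance, j, cls id, a, a', h1, h1', h2, h2', h3, h3'⟩

/-- An elementary self-map `σ` of `E` extends to an elementary self-map `τ` of an elementary
extension which moves a generic point `a = f(b)` of `A` to `g(b)`. -/
theorem exists_extension_generic_point [Finite ι] [Finite κ] {α : Ordinal.{x}}
    {B : ParamFormula L E ι} {A : ParamFormula L E κ} (σ : E ↪ₑ[L] E) (hB : IsIrreducible B)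
    (hA : MorleyRankGE α E A) (hA2 : ¬ MorleyDegreeGE α 2 E A)
    (f : RationalFunction B A) (g : RationalFunction B (push σ A))
    (hf : f.IsFinite) (hf' : f.IsDominant) (hg : g.IsFinite) (hg' : g.IsDominant) :
    ∃ (P : Type x) (_ : L.Structure P) (j : E ↪ₑ[L] P) (τ : P ↪ₑ[L] P) (b : ι → P) (a : κ → P),
      (∀ e, τ (j e) = j (σ e)) ∧ f.graph.Realize (Sum.elim j (Sum.elim b a)) ∧
      g.graph.Realize (Sum.elim j (Sum.elim b (τ ∘ a))) ∧
      ∀ C : ParamFormula L E κ, ¬ MorleyRankGE α E C → ¬ C.Realize (Sum.elim j a) := by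
  obtain ⟨β, hβ, -, hB2⟩ := hB
  obtain ⟨P, _, j, b, a, a', hfa, hga, haA, haA', hgen, hgen'⟩ := exists_generic_point hβ hB2 hA
    ((morleyRankGE_push_iff σ).2 hA) f g hf hf' hg hg'
  -- The type of `a'` over `E` contains the image under `σ` of the type of `a`.
  have htp : ∀ φ : ParamFormula L E κ, φ.Realize (Sum.elim j a) →
      φ.Realize (Sum.elim (j ∘ σ) a') := by
    intro φ hφ
    let X : ParamFormula L E κ := (A ⊓ φ : L.Formula _)
    let Y : ParamFormula L E κ := (A ⊓ Formula.not X : L.Formula _)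
    have hX : MorleyRankGE α E X := by
      by_contra hX
      exact hgen X hX (Formula.realize_inf.2 ⟨haA, hφ⟩)
    have hY : ¬ MorleyRankGE α E Y := by
      rw [← isSmall_defSet_iff]
      refine (isSmall_diff_of_not_morleyDegreeGE hA2 (fun _ h => (mem_defSet_inf.1 h).1) hX).mono ?_
      exact fun c hc => ⟨(mem_defSet_inf.1 hc).1, mem_defSet_not.1 (mem_defSet_inf.1 hc).2⟩
    have hpush : ∀ ψ : ParamFormula L E κ, (push σ ψ).Realize (Sum.elim j a') ↔
        ψ.Realize (Sum.elim (j ∘ σ) a') := fun ψ => by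
      rw [push, Formula.realize_relabel, Sum.elim_comp_map, Function.comp_id]
    have hY' := hgen' (push σ Y) ((morleyRankGE_push_iff σ).not.2 hY)
    rw [hpush] at hY' haA'
    rw [Formula.realize_inf, Formula.realize_not, Formula.realize_inf] at hY'
    tauto
  have htp' : ∀ φ : L.Formula (E ⊕ κ),
      φ.Realize (Sum.elim (j ∘ σ) a') ↔ φ.Realize (Sum.elim j a) := fun φ =>
    ⟨fun h => by_contra fun hn => Formula.realize_not.1 (htp φ.not (Formula.realize_not.2 hn)) h,
      htp φ⟩
  have : Nonempty P := ‹Nonempty E›.map j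
  obtain ⟨P₁, _, j₁, k₁, h₁⟩ := exists_amalgam htp'
  have : Nonempty P₁ := ‹Nonempty P›.map j₁
  obtain ⟨Q, _, j₂, τ, h₂⟩ := exists_elementary_endomorphism (L := L) ⟨P, P₁, j₁, k₁⟩
  have hτ : ∀ i, τ (j₂ (j₁ (Sum.elim j a i))) = j₂ (j₁ (Sum.elim (j ∘ σ) a' i)) := fun i => by
    rw [h₁]
    exact h₂ _
  let J := j₂.comp j₁
  have hJ : ∀ {ν : Type} (φ : ParamFormula L E ν) (c : ν → P),
      φ.Realize (Sum.elim (J.comp j) (J ∘ c)) ↔ φ.Realize (Sum.elim j c) := fun φ c => by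
    rw [← J.map_formula, Sum.comp_elim]
    rfl
  refine ⟨Q, _, J.comp j, τ, J ∘ b, J ∘ a, fun e => hτ (Sum.inl e), ?_, ?_, fun C hC => ?_⟩
  · rw [← Sum.comp_elim, hJ]
    exact hfa
  · have : τ ∘ (J ∘ a) = J ∘ a' := funext fun i => hτ (Sum.inr i)
    rw [this, ← Sum.comp_elim, hJ]
    exact hga
  · rw [hJ]
    exact hgen C hC

end GenericPoint

/-! ### Quantifier elimination and the model companion -/

section QuantifierElimination

variable {L : FirstOrder.Language.{u, v}} {T : L.Theory}

theorem realize_iff_of_hasQE (hQE : HasQE T) {M N : Type*} [L.Structure M] [L.Structure N]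
    [Nonempty M] (hM : M ⊨ T) (hN : N ⊨ T) (f : M ↪[L] N) {n : ℕ} (φ : L.Formula (Fin n))
    (a : Fin n → M) : φ.Realize (f ∘ a) ↔ φ.Realize a := by
  have : Nonempty N := ‹Nonempty M›.map f
  -- A dummy variable covers the case `n = 0`.
  obtain ⟨ψ, hψ, hφψ⟩ := hQE n (φ.relabel Fin.castSucc)
  have h1 := hφψ.realize_iff (M := M) (v := Fin.snoc a (Classical.arbitrary M))
  have h2 := hφψ.realize_iff (M := N) (v := f ∘ Fin.snoc a (Classical.arbitrary M))
  have h3 := hψ.realize_embedding f (v := (Fin.snoc a (Classical.arbitrary M) : Fin (n + 1) → M))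
    (xs := default)
  have h4 : (Fin.snoc a (Classical.arbitrary M) : Fin (n + 1) → M) ∘ Fin.castSucc = a :=
    funext fun i => Fin.snoc_castSucc ..
  rw [Subsingleton.elim (f ∘ default) default] at h3
  rw [Formula.realize_relabel, h4] at h1
  rw [Formula.realize_relabel, Function.comp_assoc, h4] at h2
  exact h2.trans (h3.trans h1.symm)

/-- The embedding of the `L`-reducts. -/
def reductEmbedding {M N : Type*} [L.Structure M] [(withSigma L).Structure M]
    [(LHom.sumInl : L →ᴸ withSigma L).IsExpansionOn M] [L.Structure N] [(withSigma L).Structure N]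
    [(LHom.sumInl : L →ᴸ withSigma L).IsExpansionOn N] (f : M ↪[withSigma L] N) : M ↪[L] N where
  toFun := f
  inj' := f.injective
  map_fun' g a := by
    rw [← (LHom.sumInl : L →ᴸ withSigma L).map_onFunction, f.map_fun,
      (LHom.sumInl : L →ᴸ withSigma L).map_onFunction]
  map_rel' r a := by
    rw [← (LHom.sumInl : L →ᴸ withSigma L).map_onRelation,
      ← (LHom.sumInl : L →ᴸ withSigma L).map_onRelation]
    exact f.map_rel _ _

/-- Models of the model companion of `T_σ` are models of `T_σ`: they are existentially closed in
some model of `T_σ`, and by quantifier elimination this makes them elementary `L`-substructures. -/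
theorem models_of_isModelCompanion {T : L.Theory} (hQE : HasQE T) {TA : (withSigma L).Theory}
    (hTA : IsModelCompanion.{u, v, max u v x} (sigmaTheory T) TA) (E : Type (max u v x))
    [Nonempty E] [L.Structure E] [(withSigma L).Structure E]
    [(LHom.sumInl : L →ᴸ withSigma L).IsExpansionOn E] (hE : E ⊨ TA) :
    E ⊨ T ∧ ∀ (n : ℕ) (φ : L.Formula (Fin n)) (a : Fin n → E),
      φ.Realize (sig L ∘ a) ↔ φ.Realize a := by
  obtain ⟨M, ⟨f⟩⟩ := hTA.2.1 (Theory.ModelType.of TA E)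
  obtain ⟨N, ⟨g⟩⟩ := hTA.1 M
  replace f : E ↪[withSigma L] M := f
  let _ := (LHom.sumInl : L →ᴸ withSigma L).reduct M
  let _ := (LHom.sumInl : L →ᴸ withSigma L).reduct N
  have hM : M ⊨ sigmaTheory T := M.is_model
  have hMT : M ⊨ T := ((LHom.sumInl : L →ᴸ withSigma L).onTheory_model T).1
    (hM.mono Set.subset_union_left)
  have hMσ : ∀ n (φ : L.Formula (Fin n)) (a : Fin n → M),
      φ.Realize a ↔ φ.Realize (sig L ∘ a) := fun n φ =>
    (realize_invarianceSentence φ).1 (hM.realize_of_mem _ (.inr ⟨n, φ, rfl⟩))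
  let ε : E ↪ₑ[withSigma L] N :=
    ⟨g.comp f, fun n φ a => hTA.2.2 (Theory.ModelType.of TA E) N (g.comp f) n φ a⟩
  let f' := reductEmbedding f
  let g' := reductEmbedding g
  let ζ : E ↪ₑ[L] M := f'.toElementaryEmbedding fun n φ a c hφ => by
    -- A quantifier-free formula with a solution in `M` has one in `N`, hence in `E`.
    obtain ⟨ψ, hψ, hφψ⟩ := hQE n (φ.toFormula.relabel (Sum.elim Empty.elim id))
    have hψM : ∀ b : Fin (n + 1) → M, ψ.Realize b ↔ φ.Realize default b := fun b => by
      rw [← hφψ.realize_iff, Formula.realize_relabel, BoundedFormula.realize_toFormula]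
      refine iff_of_eq (congrArg₂ _ (Subsingleton.elim _ _) rfl)
    let χ : (withSigma L).Formula (Fin n) := Formula.iExs (Fin 1)
      (((LHom.sumInl : L →ᴸ withSigma L).onFormula ψ).relabel
        (Fin.snoc (fun i => Sum.inl i) (Sum.inr 0) : Fin (n + 1) → Fin n ⊕ Fin 1))
    have hχN : χ.Realize (ε ∘ a) := by
      refine Formula.realize_iExs.2 ⟨fun _ => g c, ?_⟩
      rw [Formula.realize_relabel, LHom.realize_onFormula]
      have h1 := (hψ.realize_embedding g' (v := (Fin.snoc (f' ∘ a) c : Fin (n + 1) → M))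
        (xs := default)).2 ((hψM _).2 hφ)
      rw [Subsingleton.elim (g' ∘ default) default] at h1
      refine cast (congrArg (fun w : Fin (n + 1) → N => ψ.Realize w) (funext fun i => ?_)) h1
      refine Fin.lastCases ?_ (fun i => ?_) i
      · simp; rfl
      · simp; rfl
    rw [ε.map_formula] at hχN
    obtain ⟨b, hb⟩ := Formula.realize_iExs.1 hχN
    rw [Formula.realize_relabel, LHom.realize_onFormula] at hb
    refine ⟨b 0, (hψM _).1 ?_⟩
    have h1 := (hψ.realize_embedding f').2 hb
    rw [Subsingleton.elim (f' ∘ default) default] at h1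
    refine cast (congrArg (fun w : Fin (n + 1) → M => ψ.Realize w) (funext fun i => ?_)) h1
    refine Fin.lastCases ?_ (fun i => ?_) i
    · simp
    · simp
  refine ⟨(ζ.theory_model_iff T).2 hMT, fun n φ a => ?_⟩
  rw [← ζ.map_formula, ← ζ.map_formula φ a, hMσ n φ (ζ ∘ a)]
  refine iff_of_eq (congrArg _ (funext fun i => ?_))
  refine (f.map_fun (sigmaSymb L) ![a i]).trans ?_
  refine congrArg _ (funext fun i => ?_)
  fin_cases i
  rfl

/-- An elementary self-map of a model of `T` makes it a model of `T_σ`. -/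
theorem models_sigmaTheory {M : Type*} [L.Structure M] [(withSigma L).Structure M]
    [(LHom.sumInl : L →ᴸ withSigma L).IsExpansionOn M] (hM : M ⊨ T) (τ : M ↪ₑ[L] M)
    (hτ : ∀ m, τ m = sig L m) : M ⊨ sigmaTheory T := by
  refine Theory.Model.union (((LHom.sumInl : L →ᴸ withSigma L).onTheory_model T).2 hM) ⟨?_⟩
  rintro _ ⟨n, φ, rfl⟩
  refine (realize_invarianceSentence φ).2 fun a => ?_
  rw [← τ.map_formula φ a]
  exact iff_of_eq (congrArg _ (funext fun i => hτ (a i)))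

end QuantifierElimination

/-! ### Sharps in elementary extensions -/

section Sharps

variable {L : FirstOrder.Language.{u, v}} {E : Type x} {ι κ : Type}

/-- The `L_σ`-formula expressing that some `a ∈ (A, B)^♯` satisfies `θ`, where `(A, B)^♯` is given
by the graphs `Γ` and `Δ` of the two rational functions. -/
noncomputable def sharpFormula [Finite ι] [Finite κ] (Γ Δ : ParamFormula L E (κ ⊕ ι))
    (θ : ParamFormula L E ι) : (withSigma L).Formula E :=
  Formula.iExs (κ ⊕ ι)
    ((LHom.sumInl : L →ᴸ withSigma L).onFormula Γ ⊓
      BoundedFormula.subst ((LHom.sumInl : L →ᴸ withSigma L).onFormula Δ)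
        (Sum.elim (fun e => Term.var (Sum.inl e)) (Sum.elim (fun i => Term.var (Sum.inr (Sum.inl i)))
          (fun i => (sigmaSymb L).apply₁ (Term.var (Sum.inr (Sum.inr i)))))) ⊓
      ((LHom.sumInl : L →ᴸ withSigma L).onFormula θ).relabel (Sum.map id Sum.inr) :
      (withSigma L).Formula (E ⊕ (κ ⊕ ι)))

theorem realize_sharpFormula [Finite ι] [Finite κ] {M : Type*} [L.Structure M]
    [(withSigma L).Structure M] [(LHom.sumInl : L →ᴸ withSigma L).IsExpansionOn M]
    {Γ Δ : ParamFormula L E (κ ⊕ ι)} {θ : ParamFormula L E ι} {p : E → M} :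
    (sharpFormula Γ Δ θ).Realize p ↔ ∃ (b : κ → M) (a : ι → M),
      Γ.Realize (Sum.elim p (Sum.elim b a)) ∧
      Δ.Realize (Sum.elim p (Sum.elim b (sig L ∘ a))) ∧ θ.Realize (Sum.elim p a) := by
  have hsubst : ∀ (b : κ → M) (a : ι → M), Formula.Realize
      (BoundedFormula.subst ((LHom.sumInl : L →ᴸ withSigma L).onFormula Δ)
        (Sum.elim (fun e => Term.var (Sum.inl e)) (Sum.elim (fun i => Term.var (Sum.inr (Sum.inl i)))
          (fun i => (sigmaSymb L).apply₁ (Term.var (Sum.inr (Sum.inr i))))) :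
          E ⊕ (κ ⊕ ι) → (withSigma L).Term (E ⊕ (κ ⊕ ι))) : (withSigma L).Formula _)
        (Sum.elim p (Sum.elim b a)) ↔ Δ.Realize (Sum.elim p (Sum.elim b (sig L ∘ a))) :=
    fun b a => by
      rw [Formula.Realize, BoundedFormula.realize_subst, ← Formula.Realize, LHom.realize_onFormula]
      refine iff_of_eq (congrArg _ ?_)
      ext (i | i | i)
      · rfl
      · rfl
      · simp [sig]
  rw [sharpFormula, Formula.realize_iExs]
  constructor
  · rintro ⟨c, hc⟩
    obtain ⟨b, a, rfl⟩ : ∃ b a, c = Sum.elim b a := ⟨_, _, (Sum.elim_comp_inl_inr c).symm⟩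
    rw [Formula.realize_inf, Formula.realize_inf, hsubst, LHom.realize_onFormula,
      Formula.realize_relabel, LHom.realize_onFormula, Sum.elim_comp_map, Sum.elim_comp_inr] at hc
    exact ⟨b, a, hc.1.1, hc.1.2, hc.2⟩
  · rintro ⟨b, a, h1, h2, h3⟩
    refine ⟨Sum.elim b a, ?_⟩
    rw [Formula.realize_inf, Formula.realize_inf, hsubst, LHom.realize_onFormula,
      Formula.realize_relabel, LHom.realize_onFormula, Sum.elim_comp_map, Sum.elim_comp_inr]
    exact ⟨⟨h1, h2⟩, h3⟩

/-- An elementary self-map `τ` of a model of `T` which extends the endomorphism of `E ⊨ T_A` can be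
realized inside an elementary `L_σ`-extension of `E`. -/
theorem exists_elementary_extension_of_endomorphism {T : L.Theory} (hQE : HasQE T)
    {TA : (withSigma L).Theory}
    (hTA : IsModelCompanion.{u, v, max u v x} (sigmaTheory T) TA) {E P : Type (max u v x)}
    [Nonempty E] [L.Structure E] [(withSigma L).Structure E]
    [(LHom.sumInl : L →ᴸ withSigma L).IsExpansionOn E] (hE : E ⊨ TA) [L.Structure P]
    (j : E ↪ₑ[L] P) (τ : P ↪ₑ[L] P) (hτ : ∀ e, τ (j e) = j (sig L e)) :
    ∃ (N : Type (max u v x)) (_ : L.Structure N) (_ : (withSigma L).Structure N)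
      (_ : (LHom.sumInl : L →ᴸ withSigma L).IsExpansionOn N) (ε : E ↪ₑ[withSigma L] N)
      (h : P ↪ₑ[L] N), (∀ e, h (j e) = ε e) ∧ ∀ c, h (τ c) = sig L (h c) := by
  have : Nonempty P := ‹Nonempty E›.map j
  have hPT : P ⊨ T :=
    (j.theory_model_iff T).1 (models_of_isModelCompanion hQE hTA E hE).1
  let _ : sigmaLang.Structure P :=
    { funMap := fun {n} F => match n, F with
        | _, SigmaSymbol.sigma => fun a => τ (a 0)
      RelMap := fun {n} r => r.elim }
  have hsig : ∀ c : P, τ c = sig L c := fun c => rfl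
  have hPσ : P ⊨ sigmaTheory T := models_sigmaTheory hPT τ hsig
  let i : E ↪[withSigma L] P :=
    { toFun := j
      inj' := j.injective
      map_fun' := by
        rintro n (F | F) a
        · exact (congrArg j ((LHom.sumInl : L →ᴸ withSigma L).map_onFunction F a)).trans
            (j.map_fun F a)
        · cases F
          have ha : a = ![a 0] := by
            ext c
            fin_cases c
            rfl
          rw [ha]
          exact (hτ (a 0)).symm
      map_rel' := by
        rintro n (r | r) a
        · exact (j.map_rel r a).trans
            (iff_of_eq ((LHom.sumInl : L →ᴸ withSigma L).map_onRelation r a)).symm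
        · exact r.elim }
  obtain ⟨N, ⟨h⟩⟩ := hTA.1 (Theory.ModelType.of (sigmaTheory T) P)
  replace h : P ↪[withSigma L] N := h
  let _ := (LHom.sumInl : L →ᴸ withSigma L).reduct N
  have hNT : N ⊨ T := (models_of_isModelCompanion hQE hTA N N.is_model).1
  refine ⟨N, inferInstance, inferInstance, inferInstance, 
    ⟨h.comp i, fun n φ a => hTA.2.2 (Theory.ModelType.of TA E) N (h.comp i) n φ a⟩,
    ⟨h, fun n φ a => realize_iff_of_hasQE hQE hPT hNT (reductEmbedding h) φ a⟩,
    fun e => rfl, fun c => ?_⟩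
  refine (h.map_fun (sigmaSymb L) ![c]).trans (congrArg _ (funext fun k => ?_))
  fin_cases k
  rfl

end Sharps

end DifferenceSets

theorem proposition2 {L : FirstOrder.Language.{u, v}} (T : L.Theory)
    (hQE : DifferenceSets.HasQE T)
    (hEI : DifferenceSets.HasEI.{u, v, max u v x} T)
    (hTT : DifferenceSets.IsTotallyTranscendental.{u, v, max u v x} T)
    (TA : (DifferenceSets.withSigma L).Theory)
    (hTA : DifferenceSets.IsModelCompanion.{u, v, max u v x} (DifferenceSets.sigmaTheory T) TA)
    (E : Type (max u v x)) [Nonempty E] [L.Structure E]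
    [(DifferenceSets.withSigma L).Structure E]
    [(FirstOrder.Language.LHom.sumInl : L →ᴸ DifferenceSets.withSigma L).IsExpansionOn E]
    (hE : E ⊨ TA)
    {n m : ℕ}
    (A : DifferenceSets.ParamFormula L E (Fin n)) (B : DifferenceSets.ParamFormula L E (Fin m))
    (hA : DifferenceSets.IsIrreducible A) (hB : DifferenceSets.IsIrreducible B)
    (f : DifferenceSets.RationalFunction B A)
    (g : DifferenceSets.RationalFunction B (DifferenceSets.twist A))
    (hf : f.IsFinite) (hf' : f.IsDominant) (hg : g.IsFinite) (hg' : g.IsDominant) :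
    DifferenceSets.IsVeryDense (DifferenceSets.sharp f g) f g := by
  open DifferenceSets in
  refine ⟨subset_rfl, ?_, fun C hCA hrank hC => ?_⟩
  · rintro a ⟨b, hab, -⟩
    exact f.maps_to b a hab
  obtain ⟨α, hα, -, hA2⟩ := hA
  have hCα : ¬ MorleyRankGE α E C := by
    obtain ⟨γ, hγ, hCγ⟩ := hrank
    have hγα : γ ≤ α := by
      by_contra! h
      exact hα.2 (hγ.of_le (Order.succ_le_of_lt h))
    exact fun h => hCγ (h.of_le hγα)
  let σ : E ↪ₑ[L] E := ⟨sig L, (models_of_isModelCompanion hQE hTA E hE).2⟩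
  obtain ⟨P, _, j, τ, b, a, hτ, hfa, hga, hgen⟩ :=
    exists_extension_generic_point σ hB hα.1 hA2 f g hf hf' hg hg'
  obtain ⟨N, _, _, _, ε, h, hε, hsig⟩ :=
    exists_elementary_extension_of_endomorphism hQE hTA hE j τ hτ
  have hreal : ∀ {ν : Type} (φ : ParamFormula L E ν) (c : ν → P),
      φ.Realize (Sum.elim ε (h ∘ c)) ↔ φ.Realize (Sum.elim j c) := fun φ c => by
    rw [← h.map_formula, Sum.comp_elim]
    exact iff_of_eq (congrArg (fun p => φ.Realize (Sum.elim p (h ∘ c))) (funext fun e => (hε e).symm))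
  have hN : (sharpFormula f.graph g.graph (Formula.not C)).Realize ε := by
    refine realize_sharpFormula.2 ⟨h ∘ b, h ∘ a, ?_, ?_, ?_⟩
    · rw [← Sum.comp_elim, hreal]
      exact hfa
    · have : sig L ∘ (h ∘ a) = h ∘ (τ ∘ a) := funext fun i => (hsig (a i)).symm
      rw [this, ← Sum.comp_elim, hreal]
      exact hga
    · rw [hreal, Formula.realize_not]
      exact hgen C hCα
  obtain ⟨b', a', hf'', hg'', hC'⟩ :=
    realize_sharpFormula.1 ((ε.map_formula (sharpFormula f.graph g.graph (Formula.not C)) id).1 hN)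
  exact Formula.realize_not.1 hC' (hC ⟨b', hf'', hg''⟩)
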